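/- Let $0<d<k$ be integers and write $\mathbb{R}^k=\mathbb{R}^d\times\mathbb{R}^{k-d}$. For a linear map $L:\mathbb{R}^d\to\mathbb{R}^{k-d}$ let $E=\{(x,L(x)) : x\in\mathbb{R}^d\}$, and let $F_\pi$ be a linear complement of $E$ in $\mathbb{R}^k$ such that the projection $\pi$ onto $E$ along $F_\pi$ is injective on $\mathbb{Z}^k$; let $\pi^*$ be the projection onto $F_\pi$ along $E$. Put $\mathcal W_\pi=\pi^*(\{0\}^d\times[0,1]^{k-d})$ and $\mathcal S=\mathcal W_\pi+E$. For $s\in\mathbb{R}^k$ the cubical cut and project set is $Y_s=\pi(\mathcal S\cap(\mathbb{Z}^k+s))$; it is called regular if $\partial\mathcal S\cap(\mathbb{Z}^k+s)=\emptyset$. For $y\in Y_s$ let $\tilde y$ be the unique point of $\mathbb{Z}^k+s$ with $\pi(\tilde y)=y$. For $r>0$ the $r$-patch at $y\in Y_s$ is $$P(y,r)=\{y'\in Y_s : \tilde y'-\tilde y\in[-r,r]^d\times\mathbb{R}^{k-d}\},$$ and two $r$-patches $P(y_1,r)$, $P(y_2,r)$ are equivalent if $P(y_1,r)-y_1=P(y_2,r)-y_2$.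 Given $\phi$, the set $Y_s$ is $\phi$-repetitive if for all sufficiently large $r$, for every $y_0\in Y_s$ and every $y\in Y_s$ there is $y'\in Y_s$ with $|y'-y|<\phi(r)$ (where $|\cdot|$ is the maximum norm on $\mathbb{R}^k$) such that $P(y',r)$ is equivalent to $P(y_0,r)$. **Corollary.** Fix $\epsilon>0$. For Lebesgue almost all linear maps $L:\mathbb{R}^d\to\mathbb{R}^{k-d}$ (parametrised by their matrices in $\mathbb{R}^{d(k-d)}$) and every $F_\pi$ as above, there is a constant $C>0$, depending only on $L$, $\epsilon$ and $\pi$, such that every regular cubical cut and project set $Y_s$ is $\phi$-repetitive for every function $\phi$ that satisfies $$\phi(r)\ \ge\ C\,r^{k-d}(\log r)^{\frac{2k}{d}-1+\epsilon}$$ for all sufficiently large $r$. -/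

import Mathlib

open Filter MeasureTheory
open scoped Pointwise

namespace CutProject

/-- The total space `ℝ^k = ℝ^d × ℝ^m`, where `m = k - d`, with the maximum norm. -/
abbrev Total (d m : ℕ) : Type := (Fin d → ℝ) × (Fin m → ℝ)

/-- The integer lattice `ℤ^k` in the total space. -/
def lattice (d m : ℕ) : Set (Total d m) :=
  {z | (∀ i, ∃ n : ℤ, z.1 i = n) ∧ (∀ j, ∃ n : ℤ, z.2 j = n)}

/-- The translate `ℤ^k + s`. -/
def shiftedLattice {d m : ℕ} (s : Total d m) : Set (Total d m) :=
  {z | z - s ∈ lattice d m}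

/-- The unit cube `{0}^d × [0,1]^m` of the last `m` coordinates. -/
def cube (d m : ℕ) : Set (Total d m) :=
  {z | z.1 = 0 ∧ ∀ j, z.2 j ∈ Set.Icc (0 : ℝ) 1}

/-- The linear map `L : ℝ^d → ℝ^m` with `L(x)_i = ∑ j, α i j * x j`. -/
noncomputable def linMap {d m : ℕ} (α : Fin m → Fin d → ℝ) :
    (Fin d → ℝ) →ₗ[ℝ] (Fin m → ℝ) :=
  Matrix.toLin' (Matrix.of α)

/-- The physical space `E = {(x, L x)}`. -/
noncomputable def physicalSpace {d m : ℕ} (α : Fin m → Fin d → ℝ) :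
    Submodule ℝ (Total d m) :=
  (linMap α).graph

/-- The cylinder `C(r)` of lattice points whose first `d` coordinates lie in `[-r, r]^d`. -/
def cylinder (d m : ℕ) (r : ℝ) : Set (Total d m) :=
  {z | z ∈ lattice d m ∧ ∀ i, z.1 i ∈ Set.Icc (-r) r}

section Scheme

variable {d m : ℕ} {E F : Submodule ℝ (Total d m)}

/-- The projection `π` of the total space onto `E` along `F`. -/
noncomputable def proj (h : IsCompl E F) : Total d m →ₗ[ℝ] Total d m := E.projection F h

/-- The projection `π^*` of the total space onto `F` along `E`. -/
noncomputable def projStar (h : IsCompl E F) : Total d m →ₗ[ℝ] Total d m := F.projection E h.symm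

/-- The cubical window in the internal space `F`. -/
def window (h : IsCompl E F) : Set (Total d m) := projStar h '' cube d m

/-- The slice: the window plus the physical space. -/
def slice (h : IsCompl E F) : Set (Total d m) := window h + (E : Set (Total d m))

/-- The cubical cut and project set `Y_s`. -/
def cutProjectSet (h : IsCompl E F) (s : Total d m) : Set (Total d m) :=
  proj h '' (slice h ∩ shiftedLattice s)

/-- `s` (and `Y_s`) is regular: no point of `ℤ^k + s` lies on the boundary of the slice. -/
def IsRegular (h : IsCompl E F) (s : Total d m) : Prop :=
  frontier (slice h) ∩ shiftedLattice s = ∅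

/-- The `r`-patch `P(y, r)`. The points `z`, `z'` are the lifts of `y`, `y'` to `ℤ^k + s`; they are
unique as soon as `π` is injective on `ℤ^k`. -/
def patch (h : IsCompl E F) (s : Total d m) (y : Total d m) (r : ℝ) : Set (Total d m) :=
  {y' | y' ∈ cutProjectSet h s ∧ ∃ z ∈ shiftedLattice s, ∃ z' ∈ shiftedLattice s,
    proj h z = y ∧ proj h z' = y' ∧ z' - z ∈ cylinder d m r}

/-- Equivalence of the `r`-patches at `y₁` and `y₂`: `P(y₁, r) - y₁ = P(y₂, r) - y₂`. -/
def PatchEquiv (h : IsCompl E F) (s : Total d m) (r : ℝ) (y₁ y₂ : Total d m) : Prop :=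
  (fun y => y - y₁) '' patch h s y₁ r = (fun y => y - y₂) '' patch h s y₂ r

/-- `Y_s` is `φ`-repetitive: for all large `r`, every equivalence class of `r`-patches (given here
by a point `y₀` at which it occurs) occurs in the ball of radius `φ r` about any point of `Y_s`. -/
def IsRepetitive (h : IsCompl E F) (s : Total d m) (φ : ℝ → ℝ) : Prop :=
  ∀ᶠ r in atTop, ∀ y₀ ∈ cutProjectSet h s, ∀ y ∈ cutProjectSet h s,
    ∃ y' ∈ cutProjectSet h s, y' ∈ Metric.ball y (φ r) ∧ PatchEquiv h s r y' y₀

end Scheme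

end CutProject

/-! Put m = k - d and measure a point z by its offset z₂ - L z₁. The slice is the set of offsets in
[0,1]^m, so up to translation the patch at a lift z depends only on which side of the thresholds
α_j·n - p, |n| ≤ r, each coordinate of the offset lies. Regularity keeps offsets off all thresholds.
For almost every α, Borel–Cantelli separates the thresholds of each row by δ ≈ r^(-d) (log r)^(-σ),
where σ > 1. Hence the offsets showing a given patch contain a cube of side δ/2 (`exists_center`),
and a translate with |n| ≤ R exists once the points αn, |n| ≤ R, come within δ/4 of every vector
modulo ℤ^m (`exists_patchEquiv`).

This density comes from joint separation of all m coordinates. By Khintchine–Groshev the points αn,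
|n| ≤ X = 2^t, are 1/M-separated modulo ℤ^m with M^m ≈ X^d t^σ, which is within a logarithmic factor
of the volume bound. Chaining and pigeonhole (`reachable_of_separated`) then reach every vector in
2J steps, J of order t^σ, with |n| ≤ 2JX and error 2J/M. Requiring 2J/M ≤ δ/4 fixes X and gives R ≈
r^m (log r)^(σ(2m+d-1)/d); a suitable σ > 1 makes the last exponent 2k/d - 1. -/

namespace CutProject

/-! ### From separation to density: chaining and pigeonhole -/

/-- `x` lies within `q / M` of `f n + ℤ^m` for some `n` of size at most `q * X`. -/
def Reachable {d m : ℕ} (f : (Fin d → ℤ) →+ (Fin m → ℝ)) (X M q : ℕ) (x : Fin m → ℝ) : Prop :=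
  ∃ (n : Fin d → ℤ) (p : Fin m → ℤ),
    (∀ i, |n i| ≤ q * X) ∧ ∀ j, |x j - f n j - p j| ≤ (q : ℝ) / M

section Reachable

variable {d m : ℕ} {f : (Fin d → ℤ) →+ (Fin m → ℝ)} {X M : ℕ}

theorem Reachable.add {a b : ℕ} {x y : Fin m → ℝ} (hx : Reachable f X M a x)
    (hy : Reachable f X M b y) : Reachable f X M (a + b) (x + y) := by
  obtain ⟨n, p, hn, hp⟩ := hx
  obtain ⟨n', p', hn', hp'⟩ := hy
  refine ⟨n + n', p + p', fun i => ?_, fun j => ?_⟩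
  · have := (abs_add_le (n i) (n' i)).trans (add_le_add (hn i) (hn' i))
    simpa [add_mul] using this
  · have := (abs_add_le _ _).trans (add_le_add (hp j) (hp' j))
    have e : (x + y) j - f (n + n') j - ((p + p') j : ℤ) =
        (x j - f n j - p j) + (y j - f n' j - p' j) := by
      simp only [map_add, Pi.add_apply, Int.cast_add]
      ring
    rw [e, Nat.cast_add, add_div]
    exact this

theorem Reachable.neg {a : ℕ} {x : Fin m → ℝ} (hx : Reachable f X M a x) :
    Reachable f X M a (-x) := by
  obtain ⟨n, p, hn, hp⟩ := hx
  refine ⟨-n, -p, fun i => by simpa using hn i, fun j => ?_⟩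
  rw [← abs_neg, map_neg]
  convert hp j using 2
  simp only [Pi.neg_apply]
  push_cast
  ring

theorem Reachable.mono {a b : ℕ} (hab : a ≤ b) {x : Fin m → ℝ} (hx : Reachable f X M a x) :
    Reachable f X M b x := by
  obtain ⟨n, p, hn, hp⟩ := hx
  refine ⟨n, p, fun i => (hn i).trans ?_, fun j => (hp j).trans ?_⟩
  · gcongr
  · gcongr

theorem Reachable.of_small {a : ℕ} {x : Fin m → ℝ} (hx : ∀ j, |x j| ≤ (a : ℝ) / M) :
    Reachable f X M a x :=
  ⟨0, 0, fun i => by simp; positivity, fun j => by simpa using hx j⟩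

/-- A vector that cannot be reached in `2 J` steps yields `J + 1` points whose differences cannot
be reached in one step. -/
theorem exists_separated_of_not_reachable (hM : 0 < M) {J : ℕ} {x : Fin m → ℝ}
    (hx : ¬ Reachable f X M (2 * J) x) :
    ∃ y : Fin (J + 1) → Fin m → ℝ, ∀ i i', Reachable f X M 1 (y i - y i') → i = i' := by
  have hM' : (0 : ℝ) < M := by exact_mod_cast hM
  obtain ⟨Q, hQ1, hQ⟩ : ∃ Q : ℕ, 0 < Q ∧ ∀ j, |x j| ≤ (Q : ℝ) / M := by
    obtain ⟨Q, hQ⟩ := exists_nat_ge (‖x‖ * M)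
    refine ⟨Q + 1, Nat.succ_pos _, fun j => ?_⟩
    rw [le_div_iff₀ hM']
    have h1 : |x j| ≤ ‖x‖ := by simpa using norm_le_pi_norm x j
    push_cast
    nlinarith
  have hQ' : (0 : ℝ) < Q := by exact_mod_cast hQ1
  -- The segment from 0 to x, cut into Q pieces short enough to count as one step each.
  let w : ℕ → Fin m → ℝ := fun q => ((q : ℝ) / Q) • x
  have hstep : ∀ q, Reachable f X M 1 (w (q + 1) - w q) := fun q => by
    refine Reachable.of_small fun j => ?_
    have : (w (q + 1) - w q) j = x j / Q := by
      simp only [w, Pi.sub_apply, Pi.smul_apply, smul_eq_mul]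
      push_cast
      field_simp
      ring
    rw [this, abs_div, abs_of_pos hQ', div_le_iff₀ hQ']
    calc |x j| ≤ Q / M := hQ j
      _ = _ := by push_cast; ring
  -- If 2i + 1 steps never reached more than 2i steps do, induction along the segment would reach x
  -- itself.
  have key : ∀ i : Fin (J + 1), ∃ y : Fin m → ℝ,
      Reachable f X M (2 * i + 1) y ∧ ¬ Reachable f X M (2 * i) y := by
    intro i
    by_contra! hcon
    have : ∀ q, Reachable f X M (2 * i) (w q) := by
      intro q
      induction q with
      | zero => exact Reachable.of_small fun j => by simp [w]; positivity
      | succ q ih =>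
        apply hcon
        simpa using ih.add (hstep q)
    apply hx
    have h2 := (this Q).mono (b := 2 * J) (by omega)
    have hw : w Q = x := by
      simp only [w]
      rw [div_self hQ'.ne', one_smul]
    rwa [hw] at h2
  choose y hy1 hy2 using key
  -- One step from y i' would reach y i in 2i' + 2 ≤ 2i steps; this is why levels are spaced by two.
  have hlt : ∀ i i' : Fin (J + 1), i' < i → ¬ Reachable f X M 1 (y i - y i') := by
    intro i i' hii h
    apply hy2 i
    have h3 := h.add (hy1 i')
    rw [sub_add_cancel] at h3
    exact h3.mono (by have := Fin.lt_def.1 hii; omega)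
  refine ⟨y, fun i i' h => ?_⟩
  rcases lt_trichotomy i i' with hii | hii | hii
  · exact absurd (by simpa using h.neg) (hlt i' i hii)
  · exact hii
  · exact absurd h (hlt i i' hii)

/-- Residues of ⌊Mv⌋ modulo M label the M cells of length 1/M on the circle; these are the
pigeonholes below. -/
theorem exists_int_abs_sub_lt_of_floor_eq (hM : 0 < M) {v v' : ℝ}
    (h : (⌊M * v⌋ : ZMod M) = (⌊M * v'⌋ : ZMod M)) : ∃ p : ℤ, |v - v' - p| < 1 / (M : ℝ) := by
  have hM' : (0 : ℝ) < M := by exact_mod_cast hM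
  obtain ⟨p, hp⟩ := (ZMod.intCast_eq_intCast_iff_dvd_sub _ _ _).1 h
  refine ⟨-p, ?_⟩
  have h1 := Int.floor_le (M * v)
  have h2 := Int.lt_floor_add_one (M * v)
  have h3 := Int.floor_le (M * v')
  have h4 := Int.lt_floor_add_one (M * v')
  have hp' : (⌊M * v'⌋ : ℝ) - ⌊M * v⌋ = M * p := by exact_mod_cast hp
  rw [Int.cast_neg, abs_lt, ← neg_div, lt_div_iff₀ hM', div_lt_iff₀ hM']
  constructor <;> nlinarith

/-- If the points `f n` with `n` small are `1 / M`-separated modulo `ℤ^m`, then every vector is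
reached in `2 J` steps, where `J` is the ratio of `M ^ m` to the number of these points. -/
theorem reachable_of_separated (hM : 0 < M) {J : ℕ} (hJ : M ^ m < (J + 1) * X ^ d)
    (H : ∀ n : Fin d → ℤ, n ≠ 0 → (∀ i, |n i| ≤ X) → ∀ p : Fin m → ℤ,
      ∃ j, 1 / (M : ℝ) ≤ |f n j - p j|) (x : Fin m → ℝ) :
    Reachable f X M (2 * J) x := by
  by_contra hx
  obtain ⟨y, hy⟩ := exists_separated_of_not_reachable hM hx
  have : NeZero M := ⟨hM.ne'⟩
  let e : (Fin d → Fin X) → Fin d → ℤ := fun n i => ((n i : ℕ) : ℤ)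
  let g : Fin (J + 1) × (Fin d → Fin X) → Fin m → ZMod M := fun a j =>
    ((⌊(M : ℝ) * (y a.1 j + f (e a.2) j)⌋ : ℤ) : ZMod M)
  obtain ⟨⟨i, n⟩, ⟨i', n'⟩, hne, heq⟩ := Fintype.exists_ne_map_eq_of_card_lt g (by simpa using hJ)
  have hclose : ∀ j, ∃ p : ℤ, |(y i j + f (e n) j) - (y i' j + f (e n') j) - p| < 1 / (M : ℝ) :=
    fun j => exists_int_abs_sub_lt_of_floor_eq hM (congrFun heq j)
  choose p hp using hclose
  have hsize : ∀ l, |(e n' - e n) l| ≤ X := fun l => by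
    have h1 := (n l).2
    have h2 := (n' l).2
    simp only [e, Pi.sub_apply]
    rw [abs_le]
    constructor <;> omega
  -- Two of the (J + 1) X^d points share one of the M^m cells. Separation of the y's forces equal i,
  -- and then `H` is violated by n' - n.
  have hii : i = i' := by
    apply hy
    refine ⟨e n' - e n, p, by simpa using hsize, fun j => ?_⟩
    have e : (y i - y i') j - f (e n' - e n) j - (p j : ℤ) =
        (y i j + f (e n) j) - (y i' j + f (e n') j) - p j := by
      simp only [map_sub, Pi.sub_apply]
      ring
    rw [e, Nat.cast_one]
    exact (hp j).le
  subst hii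
  have hnn : e n' - e n ≠ 0 := by
    intro h0
    apply hne
    congr 1
    funext l
    have := congrFun h0 l
    simp only [e, Pi.sub_apply, Pi.zero_apply] at this
    exact Fin.ext (by omega)
  obtain ⟨j, hj⟩ := H _ hnn hsize (-p)
  apply absurd hj
  have e : f (e n' - e n) j - ((-p) j : ℤ) =
      -((y i j + f (e n) j) - (y i j + f (e n') j) - p j) := by
    simp only [map_sub, Pi.sub_apply, Pi.neg_apply, Int.cast_neg]
    ring
  rw [not_le, e, abs_neg]
  exact hp j

end Reachable

/-! ### Metric Diophantine approximation: the convergence case -/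

theorem volume_near_int_le (B : ℕ) {δ : ℝ} (hδ1 : δ ≤ 1) :
    volume {x : ℝ | |x| ≤ B ∧ ∃ p : ℤ, |x - p| ≤ δ} ≤ ENNReal.ofReal ((2 * B + 3) * (2 * δ)) := by
  have hsub : {x : ℝ | |x| ≤ B ∧ ∃ p : ℤ, |x - p| ≤ δ} ⊆
      ⋃ p ∈ Finset.Icc (-(B + 1) : ℤ) (B + 1), Metric.closedBall (p : ℝ) δ := by
    rintro x ⟨hx, p, hp⟩
    simp only [Set.mem_iUnion, Finset.mem_Icc, exists_prop]
    refine ⟨p, ?_, by simpa [Real.dist_eq] using hp⟩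
    rw [abs_le] at hx hp
    constructor
    · have : (-(B + 1) : ℝ) ≤ p := by linarith
      exact_mod_cast this
    · have : (p : ℝ) ≤ B + 1 := by linarith
      exact_mod_cast this
  refine (measure_mono hsub).trans ((measure_biUnion_finset_le _ _).trans ?_)
  simp only [Real.volume_closedBall, Finset.sum_const, nsmul_eq_mul, Int.card_Icc]
  have h1 : ((B : ℤ) + 1 + 1 - -(B + 1)).toNat = 2 * B + 3 := by omega
  rw [h1, ← ENNReal.ofReal_natCast, ← ENNReal.ofReal_mul (Nat.cast_nonneg _)]
  exact ENNReal.ofReal_le_ofReal (by push_cast; exact le_rfl)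

/-- The vectors of a cube whose product with a fixed nonzero integer vector is `δ`-close to an
integer form a set of volume `O(δ)`. -/
theorem volume_dot_near_int_le {d : ℕ} (K : ℕ) {δ : ℝ} (hδ : 0 ≤ δ) (hδ1 : δ ≤ 1)
    {n : Fin d → ℤ} (hn : n ≠ 0) :
    volume {a : Fin d → ℝ | (∀ i, |a i| ≤ K) ∧ ∃ p : ℤ, |∑ i, a i * n i - p| ≤ δ} ≤
      ENNReal.ofReal ((2 * K) ^ (d - 1) * ((2 * (K * d) + 3) * 2) * δ) := by
  obtain ⟨i₁, hi₁⟩ := Function.ne_iff.1 hn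
  obtain ⟨i₀, -, hmax⟩ := Finset.exists_max_image Finset.univ (fun i => |n i|)
    ⟨i₁, Finset.mem_univ _⟩
  have hpos : 0 < |n i₀| := (abs_pos.2 hi₁).trans_le (hmax i₁ (Finset.mem_univ _))
  obtain ⟨N, hN⟩ := Int.eq_ofNat_of_zero_le hpos.le
  have hN1 : 1 ≤ N := by omega
  have hNr : |(n i₀ : ℝ)| = N := by exact_mod_cast congrArg (Int.cast : ℤ → ℝ) hN
  -- Replace the coordinate where |n i| is largest, equal to N, by the form a·n. The form passes
  -- O(N) integers on the cube, and the determinant ±N cancels this, so the bound is uniform in n.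
  let A : Matrix (Fin d) (Fin d) ℝ := (1 : Matrix (Fin d) (Fin d) ℝ).updateRow i₀ fun i => n i
  have hdetA : A.det = n i₀ := by
    rw [← Matrix.cramer_transpose_apply, Matrix.transpose_one, Matrix.cramer_one]
    rfl
  have hdet : LinearMap.det (Matrix.toLin' A) = n i₀ := by rw [LinearMap.det_toLin', hdetA]
  have hne : (n i₀ : ℝ) ≠ 0 := by exact_mod_cast abs_pos.1 hpos
  have hA0 : ∀ a : Fin d → ℝ, Matrix.toLin' A a i₀ = ∑ i, a i * n i := fun a => by
    simp [A, Matrix.toLin'_apply, Matrix.mulVec, dotProduct, mul_comm]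
  have hA1 : ∀ (a : Fin d → ℝ) (i : Fin d), i ≠ i₀ → Matrix.toLin' A a i = a i := fun a i hi => by
    simp [A, Matrix.toLin'_apply, Matrix.mulVec, dotProduct, Matrix.updateRow_ne hi,
      Matrix.one_apply]
  let B : ℕ := K * d * N
  let S : Fin d → Set ℝ := Function.update (fun _ => Set.Icc (-(K : ℝ)) K) i₀
    {x : ℝ | |x| ≤ B ∧ ∃ p : ℤ, |x - p| ≤ δ}
  have hsub : {a : Fin d → ℝ | (∀ i, |a i| ≤ K) ∧ ∃ p : ℤ, |∑ i, a i * n i - p| ≤ δ} ⊆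
      Matrix.toLin' A ⁻¹' (Set.univ.pi S) := by
    rintro a ⟨ha, hp⟩
    rw [Set.mem_preimage, Set.mem_univ_pi]
    intro i
    by_cases hi : i = i₀
    · subst hi
      simp only [S, Function.update_self, hA0]
      refine ⟨?_, hp⟩
      calc |∑ l, a l * n l| ≤ ∑ l, |a l * n l| := Finset.abs_sum_le_sum_abs _ _
        _ ≤ ∑ _l : Fin d, (K : ℝ) * N := Finset.sum_le_sum fun l _ => by
            rw [abs_mul]
            gcongr
            · exact ha l
            · rw [← hNr]
              exact_mod_cast hmax l (Finset.mem_univ _)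
        _ = B := by
            simp only [Finset.sum_const, Finset.card_univ, Fintype.card_fin, nsmul_eq_mul, B]
            push_cast
            ring
    · simp only [S, Function.update_of_ne hi, hA1 a i hi]
      exact abs_le.1 (ha i)
  refine (measure_mono hsub).trans ?_
  rw [Measure.addHaar_preimage_linearMap _ (by rw [hdet]; exact hne), hdet, volume_pi_pi,
    ← Finset.mul_prod_erase _ _ (Finset.mem_univ i₀)]
  have hprod : ∏ i ∈ Finset.univ.erase i₀, volume (S i) = ENNReal.ofReal ((2 * K) ^ (d - 1)) := by
    rw [Finset.prod_congr rfl (g := fun _ => ENNReal.ofReal (2 * K))]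
    · rw [Finset.prod_const, Finset.card_erase_of_mem (Finset.mem_univ _), Finset.card_univ,
        Fintype.card_fin, ENNReal.ofReal_pow (by positivity)]
    · intro i hi
      simp only [S, Function.update_of_ne (Finset.ne_of_mem_erase hi), Real.volume_Icc]
      congr 1
      ring
  have hS0 : volume (S i₀) ≤ ENNReal.ofReal ((2 * B + 3) * (2 * δ)) := by
    simp only [S, Function.update_self]
    exact volume_near_int_le B hδ1
  rw [hprod]
  calc ENNReal.ofReal |(n i₀ : ℝ)⁻¹| * (volume (S i₀) * ENNReal.ofReal ((2 * K) ^ (d - 1)))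
      ≤ ENNReal.ofReal |(n i₀ : ℝ)⁻¹| * (ENNReal.ofReal ((2 * B + 3) * (2 * δ)) *
          ENNReal.ofReal ((2 * K) ^ (d - 1))) := by gcongr
    _ ≤ _ := by
      rw [← ENNReal.ofReal_mul (by positivity), ← ENNReal.ofReal_mul (by positivity), abs_inv, hNr]
      apply ENNReal.ofReal_le_ofReal
      have hNr1 : (1 : ℝ) ≤ N := by exact_mod_cast hN1
      have hNpos : (0 : ℝ) < N := by positivity
      rw [inv_mul_le_iff₀ hNpos]
      have h3 : (2 * B + 3 : ℝ) ≤ N * (2 * (K * d) + 3) := by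
        simp only [B]
        push_cast
        nlinarith
      calc (2 * B + 3 : ℝ) * (2 * δ) * (2 * K) ^ (d - 1)
          ≤ N * (2 * (K * d) + 3) * (2 * δ) * (2 * K) ^ (d - 1) := by gcongr
        _ = _ := by ring

/-- The convergence case of the Khintchine–Groshev theorem along powers of two. -/
theorem ae_eventually_forall_lt_abs_sub {ι : Type*} [Fintype ι] {d : ℕ} {ψ : ℕ → ℝ}
    (hψ : ∀ t, 0 ≤ ψ t) (hψ1 : ∀ t, ψ t ≤ 1)
    (hsum : Summable fun t : ℕ => ((2 : ℝ) ^ t) ^ d * ψ t ^ Fintype.card ι) :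
    ∀ᵐ α : ι → Fin d → ℝ, ∀ᶠ t : ℕ in atTop, ∀ n : Fin d → ℤ, n ≠ 0 → (∀ i, |n i| ≤ 2 ^ t) →
      ∀ p : ι → ℤ, ∃ j, ψ t < |∑ i, α j i * n i - p j| := by
  let box : ℕ → Finset (Fin d → ℤ) := fun t =>
    Fintype.piFinset fun _ => Finset.Icc (-(2 ^ t) : ℤ) (2 ^ t)
  let V : ℕ → ℕ → (Fin d → ℤ) → Set (Fin d → ℝ) := fun K t n =>
    {a | (∀ i, |a i| ≤ K) ∧ ∃ p : ℤ, |∑ i, a i * n i - p| ≤ ψ t}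
  let W : ℕ → ℕ → Set (ι → Fin d → ℝ) := fun K t =>
    ⋃ n ∈ (box t).erase 0, Set.univ.pi fun _ => V K t n
  -- Borel–Cantelli needs finite volume, hence boxes of size K; countably many of them exhaust all
  -- matrices.
  have hW : ∀ K, ∀ᵐ α : ι → Fin d → ℝ, ∀ᶠ t in atTop, α ∉ W K t := by
    intro K
    apply ae_eventually_notMem
    set c : ℝ := (2 * K) ^ (d - 1) * ((2 * (K * d) + 3) * 2)
    have hc : 0 ≤ c := by positivity
    have hle : ∀ t, volume (W K t) ≤
        ENNReal.ofReal (3 ^ d * c ^ Fintype.card ι *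
          (((2 : ℝ) ^ t) ^ d * ψ t ^ Fintype.card ι)) := by
      intro t
      have hcard : (((box t).erase 0).card : ℝ) ≤ (3 * 2 ^ t) ^ d := by
        have h1 : ((box t).erase 0).card ≤ (2 * 2 ^ t + 1) ^ d := by
          refine (Finset.card_erase_le).trans (le_of_eq ?_)
          simp only [box, Fintype.card_piFinset, Int.card_Icc, Finset.prod_const, Finset.card_univ,
            Fintype.card_fin]
          congr 1
          have : (2 ^ t + 1 - -2 ^ t : ℤ) = ((2 * 2 ^ t + 1 : ℕ) : ℤ) := by push_cast; ring
          rw [this, Int.toNat_natCast]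
        have h2 : (1 : ℝ) ≤ 2 ^ t := one_le_pow₀ (by norm_num)
        calc (((box t).erase 0).card : ℝ) ≤ ((2 * 2 ^ t + 1) ^ d : ℕ) := by exact_mod_cast h1
          _ = (2 * 2 ^ t + 1 : ℝ) ^ d := by push_cast; rfl
          _ ≤ _ := by gcongr; linarith
      calc volume (W K t) ≤ ∑ n ∈ (box t).erase 0, volume (Set.univ.pi fun _ : ι => V K t n) :=
            measure_biUnion_finset_le _ _
        _ ≤ ∑ _n ∈ (box t).erase 0, ENNReal.ofReal ((c * ψ t) ^ Fintype.card ι) := by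
            refine Finset.sum_le_sum fun n hn => ?_
            rw [volume_pi_pi, Finset.prod_const, Finset.card_univ,
              ENNReal.ofReal_pow (mul_nonneg hc (hψ t))]
            gcongr
            exact volume_dot_near_int_le K (hψ t) (hψ1 t) (Finset.ne_of_mem_erase hn)
        _ = ENNReal.ofReal (((box t).erase 0).card * (c * ψ t) ^ Fintype.card ι) := by
            rw [Finset.sum_const, nsmul_eq_mul, ENNReal.ofReal_mul (by positivity),
              ENNReal.ofReal_natCast]
        _ ≤ _ := by
            apply ENNReal.ofReal_le_ofReal
            calc (((box t).erase 0).card : ℝ) * (c * ψ t) ^ Fintype.card ι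
                ≤ (3 * 2 ^ t) ^ d * (c * ψ t) ^ Fintype.card ι := by
                  have := mul_nonneg hc (hψ t)
                  gcongr
              _ = _ := by
                rw [mul_pow, mul_pow]
                ring
    refine ne_top_of_le_ne_top ?_ (ENNReal.tsum_le_tsum hle)
    rw [← ENNReal.ofReal_tsum_of_nonneg
      (fun t => by have := hψ t; positivity) (hsum.mul_left _)]
    exact ENNReal.ofReal_ne_top
  filter_upwards [ae_all_iff.2 hW] with α hα
  obtain ⟨K, hK⟩ := exists_nat_ge (∑ j, ∑ i, |α j i|)
  filter_upwards [hα K] with t ht n hn hnt p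
  by_contra! hcon
  apply ht
  simp only [W, Set.mem_iUnion, exists_prop, Finset.mem_erase, box, Fintype.mem_piFinset,
    Finset.mem_Icc, Set.mem_univ_pi]
  refine ⟨n, ⟨hn, fun i => abs_le.1 (hnt i)⟩, fun j => ⟨fun i => ?_, p j, hcon j⟩⟩
  refine le_trans ?_ hK
  calc |α j i| ≤ ∑ i, |α j i| :=
        Finset.single_le_sum (f := fun i => |α j i|) (fun _ _ => abs_nonneg _) (Finset.mem_univ i)
    _ ≤ _ := Finset.single_le_sum (f := fun j => ∑ i, |α j i|)
        (fun _ _ => Finset.sum_nonneg fun _ _ => abs_nonneg _) (Finset.mem_univ j)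

/-- The same for a single linear form, simultaneously for all rows of a matrix. -/
theorem ae_forall_row_eventually_forall_lt_abs_sub {ι : Type*} [Fintype ι] {d : ℕ} {ψ : ℕ → ℝ}
    (hψ : ∀ t, 0 ≤ ψ t) (hψ1 : ∀ t, ψ t ≤ 1)
    (hsum : Summable fun t : ℕ => ((2 : ℝ) ^ t) ^ d * ψ t) :
    ∀ᵐ α : ι → Fin d → ℝ, ∀ j, ∀ᶠ t : ℕ in atTop, ∀ n : Fin d → ℤ, n ≠ 0 →
      (∀ i, |n i| ≤ 2 ^ t) → ∀ p : ℤ, ψ t < |∑ i, α j i * n i - p| := by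
  rw [ae_all_iff]
  intro j
  have h1 := ae_eventually_forall_lt_abs_sub (ι := Unit) hψ hψ1 (by simpa using hsum)
  have h2 : ∀ᵐ a : Fin d → ℝ, ∀ᶠ t : ℕ in atTop, ∀ n : Fin d → ℤ, n ≠ 0 →
      (∀ i, |n i| ≤ 2 ^ t) → ∀ p : ℤ, ψ t < |∑ i, a i * n i - p| := by
    filter_upwards [((volume_preserving_funUnique Unit (Fin d → ℝ)).symm).quasiMeasurePreserving.ae
      h1] with a ha
    filter_upwards [ha] with t ht n hn hnt p
    obtain ⟨_, hj⟩ := ht n hn hnt fun _ => p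
    exact hj
  exact (Measure.tendsto_eval_ae_ae (μ := fun _ : ι => (volume : Measure (Fin d → ℝ)))
    (i := j)).eventually h2

/-! ### Approximation rates and choice of scales -/

/-- The size `2^(td) t^σ` that governs the approximation rates at scale `2^t`. -/
noncomputable def rate (d : ℕ) (σ : ℝ) (t : ℕ) : ℝ := ((2 : ℝ) ^ t) ^ d * (t : ℝ) ^ σ

theorem rate_nonneg (d : ℕ) (σ : ℝ) (t : ℕ) : 0 ≤ rate d σ t := by
  unfold rate
  positivity

theorem one_le_rate {d : ℕ} {σ : ℝ} (hσ : 0 ≤ σ) {t : ℕ} (ht : 1 ≤ t) : 1 ≤ rate d σ t :=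
  one_le_mul_of_one_le_of_one_le (one_le_pow₀ (one_le_pow₀ (by norm_num)))
    (Real.one_le_rpow (by exact_mod_cast ht) hσ)

theorem rate_rpow_inv_le_one {d : ℕ} {σ : ℝ} (hσ : 0 < σ) (m : ℕ) (hm : 0 < m) (t : ℕ) :
    (rate d σ t ^ ((m : ℝ)⁻¹))⁻¹ ≤ 1 := by
  -- At t = 0 the rate is 0, and so is its inverse by convention.
  rcases Nat.eq_zero_or_pos t with rfl | ht
  · have : ((m : ℝ)⁻¹) ≠ 0 := by positivity
    simp [rate, Real.zero_rpow hσ.ne', Real.zero_rpow this]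
  · exact inv_le_one_of_one_le₀ (Real.one_le_rpow (one_le_rate hσ.le ht) (by positivity))

/-- The terms are t^(-σ) for t ≥ 1; both Borel–Cantelli series reduce to this one. -/
theorem summable_rate {d : ℕ} {σ : ℝ} (hσ : 1 < σ) :
    Summable fun t : ℕ => ((2 : ℝ) ^ t) ^ d * (rate d σ t)⁻¹ := by
  refine (Real.summable_one_div_nat_rpow.2 hσ).congr fun t => ?_
  have : (((2 : ℝ) ^ t) ^ d) ≠ 0 := by positivity
  rw [rate, mul_inv, mul_inv_cancel_left₀ this, one_div]

theorem eventually_mul_rpow_le_two_pow (g e : ℝ) (hg : 0 < g) :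
    ∀ᶠ T : ℕ in atTop, 2 * (g * (T : ℝ) ^ e) ≤ 2 ^ T := by
  have h := (isLittleO_rpow_exp_pos_mul_atTop e (Real.log_pos one_lt_two)).bound
    (c := (2 * g)⁻¹) (by positivity)
  filter_upwards [tendsto_natCast_atTop_atTop.eventually h] with T hT
  rw [Real.norm_of_nonneg (by positivity), Real.norm_of_nonneg (by positivity),
    le_inv_mul_iff₀ (by positivity), Real.exp_mul, Real.exp_log two_pos, Real.rpow_natCast] at hT
  linarith

/-- Choice of the parameters in `reachable_of_separated`. -/
theorem exists_parameters {d m : ℕ} (hd : 0 < d) (hm : 0 < m) {σ : ℝ} (hσ : 1 < σ) :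
    ∃ K : ℝ, 0 < K ∧ ∀ᶠ T : ℕ in atTop, ∃ t ≥ T, ∃ M J : ℕ, 0 < M ∧
      1 / (M : ℝ) ≤ (rate d σ t ^ ((m : ℝ)⁻¹))⁻¹ ∧ M ^ m < (J + 1) * (2 ^ t) ^ d ∧
      2 * (J : ℝ) / M ≤ (rate d σ T)⁻¹ / 4 ∧
      2 * (J : ℝ) * 2 ^ t ≤ K * (2 ^ T) ^ m * (T : ℝ) ^ (σ * (2 * m + d - 1) / d) := by
  have hσ0 : 0 < σ := by linarith
  have hdr : (0 : ℝ) < d := by exact_mod_cast hd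
  -- Bounds (t/T)^σ, as t ≤ (m + 1) T below.
  set b : ℝ := ((m : ℝ) + 1) ^ σ with hb
  have hb1 : 1 ≤ b := Real.one_le_rpow (by simp) hσ0.le
  have hbpos : 0 < b := by linarith
  -- The error bound reduces to `hkey`. Its m-th power, divided by s and with s ≤ bτ, asks for G
  -- 2^(Tdm) τ^(2m-1) ≤ 2^(td). The d-th root of the left side is Z, whence g, e and Y.
  set G : ℝ := (2 ^ (m + 3)) ^ m * b ^ (m - 1) with hG
  have hG1 : 1 ≤ G := one_le_mul_of_one_le_of_one_le (one_le_pow₀ (one_le_pow₀ (by norm_num)))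
    (one_le_pow₀ hb1)
  have hGpos : 0 < G := by linarith
  set g : ℝ := G ^ ((d : ℝ)⁻¹) with hg
  have hg1 : 1 ≤ g := Real.one_le_rpow hG1 (by positivity)
  have hgd : g ^ d = G := Real.rpow_inv_natCast_pow hGpos.le hd.ne'
  have hgpos : 0 < g := by linarith
  set e : ℝ := σ * (2 * m - 1) / d with he
  have hm1 : (1 : ℝ) ≤ m := by exact_mod_cast hm
  have he0 : 0 ≤ e := by
    have : (0 : ℝ) ≤ 2 * m - 1 := by linarith
    positivity
  refine ⟨2 ^ (m + 2) * b * g, by positivity, ?_⟩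
  filter_upwards [eventually_mul_rpow_le_two_pow g e hgpos, eventually_ge_atTop 1] with T hT hT1
  have hT1r : (1 : ℝ) ≤ T := by exact_mod_cast hT1
  have hTpos : (0 : ℝ) < T := by linarith
  set τ : ℝ := (T : ℝ) ^ σ with hτ
  have hτ1 : 1 ≤ τ := Real.one_le_rpow hT1r hσ0.le
  have hτpos : 0 < τ := by linarith
  set Y : ℝ := g * (T : ℝ) ^ e with hY
  have hY1 : 1 ≤ Y := one_le_mul_of_one_le_of_one_le hg1 (Real.one_le_rpow hT1r he0)
  have hYd : Y ^ d = G * τ ^ (m - 1) * τ ^ m := by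
    rw [hY, mul_pow, hgd, mul_assoc G, ← pow_add, hτ, ← Real.rpow_natCast (_ ^ e),
      ← Real.rpow_natCast (_ ^ σ), ← Real.rpow_mul hTpos.le, ← Real.rpow_mul hTpos.le]
    congr 2
    rw [he, div_mul_cancel₀ _ hdr.ne', Nat.cast_add, Nat.cast_sub hm]
    push_cast
    ring
  set Z : ℝ := (2 ^ T) ^ m * Y with hZ
  have h2T : (1 : ℝ) ≤ 2 ^ T := one_le_pow₀ (by norm_num)
  have hZT : (2 : ℝ) ^ T ≤ Z := by
    calc (2 : ℝ) ^ T ≤ (2 ^ T) ^ m := le_self_pow₀ h2T hm.ne'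
      _ ≤ Z := le_mul_of_one_le_right (by positivity) hY1
  obtain ⟨t', ht1, ht2⟩ := exists_nat_pow_near (x := Z) (y := 2) (h2T.trans hZT) (by norm_num)
  set t := t' + 1 with ht
  have htZ : (2 : ℝ) ^ t ≤ 2 * Z := by
    rw [ht, pow_succ]
    linarith
  have hTt : T ≤ t := ((pow_lt_pow_iff_right₀ (one_lt_two (α := ℝ))).1 (hZT.trans_lt ht2)).le
  have htT : t ≤ (m + 1) * T := by
    rw [← pow_le_pow_iff_right₀ (one_lt_two (α := ℝ))]
    calc (2 : ℝ) ^ t ≤ (2 ^ T) ^ m * (2 * Y) := by rw [hZ] at htZ; linarith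
      _ ≤ (2 ^ T) ^ m * 2 ^ T := by gcongr
      _ = 2 ^ ((m + 1) * T) := by rw [← pow_succ, ← pow_mul, mul_comm]
  have htr : (1 : ℝ) ≤ t := by exact_mod_cast hT1.trans hTt
  set s : ℝ := (t : ℝ) ^ σ with hs
  have hs1 : 1 ≤ s := Real.one_le_rpow htr hσ0.le
  have hspos : 0 < s := by linarith
  have hsb : s ≤ b * τ := by
    rw [hs, hb, hτ, ← Real.mul_rpow (by positivity) (by positivity)]
    apply Real.rpow_le_rpow (by positivity) _ hσ0.le
    exact_mod_cast htT
  set D : ℝ := (2 ^ t) ^ d with hD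
  have hDpos : 0 < D := by positivity
  have hA : rate d σ t = D * s := rfl
  set a : ℝ := rate d σ t ^ ((m : ℝ)⁻¹) with ha
  have ham : a ^ m = D * s := by
    rw [ha, Real.rpow_inv_natCast_pow (rate_nonneg _ _ _) hm.ne', hA]
  have ha1 : 1 ≤ a := Real.one_le_rpow (one_le_rate hσ0.le (hT1.trans hTt)) (by positivity)
  have hapos : 0 < a := by linarith
  have hMa : a ≤ (⌈a⌉₊ : ℝ) := Nat.le_ceil a
  have hM2 : (⌈a⌉₊ : ℝ) ≤ 2 * a := by linarith [Nat.ceil_lt_add_one hapos.le]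
  have hMpos : (0 : ℝ) < (⌈a⌉₊ : ℝ) := by linarith
  set J : ℕ := ⌈a⌉₊ ^ m / (2 ^ t) ^ d with hJ
  have hJs : (J : ℝ) ≤ 2 ^ m * s := by
    have h1 : (J : ℝ) * D ≤ (⌈a⌉₊ : ℝ) ^ m := by
      rw [hD]
      exact_mod_cast Nat.div_mul_le_self _ _
    have h2 : (⌈a⌉₊ : ℝ) ^ m ≤ 2 ^ m * s * D := by
      calc (⌈a⌉₊ : ℝ) ^ m ≤ (2 * a) ^ m := by gcongr
        _ = _ := by rw [mul_pow, ham]; ring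
    exact le_of_mul_le_mul_right (h1.trans h2) hDpos
  refine ⟨t, hTt, ⌈a⌉₊, J, Nat.ceil_pos.2 hapos, ?_, ?_, ?_, ?_⟩
  · rw [one_div]
    exact inv_anti₀ hapos hMa
  · rw [mul_comm]
    exact Nat.lt_mul_div_succ _ (by positivity)
  · have hkey : 2 ^ (m + 3) * (2 ^ T) ^ d * τ * s ≤ a := by
      rw [← pow_le_pow_iff_left₀ (by positivity) hapos.le hm.ne', ham, mul_pow _ s,
        ← pow_sub_one_mul hm.ne' s, ← mul_assoc]
      gcongr
      calc (2 ^ (m + 3) * (2 ^ T) ^ d * τ) ^ m * s ^ (m - 1)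
          ≤ (2 ^ (m + 3) * (2 ^ T) ^ d * τ) ^ m * (b * τ) ^ (m - 1) := by gcongr
        _ = Z ^ d := by
            rw [hZ, mul_pow _ Y, hYd, hG, mul_pow, mul_pow, mul_pow, pow_right_comm]
            ring
        _ ≤ D := by
            rw [hD]
            gcongr
    have hR : rate d σ T = (2 ^ T) ^ d * τ := rfl
    rw [hR, div_le_div_iff₀ hMpos (by norm_num), inv_mul_eq_div, le_div_iff₀ (by positivity)]
    calc 2 * (J : ℝ) * 4 * ((2 ^ T) ^ d * τ) ≤ 2 * (2 ^ m * s) * 4 * ((2 ^ T) ^ d * τ) := by gcongr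
      _ = 2 ^ (m + 3) * (2 ^ T) ^ d * τ * s := by ring
      _ ≤ _ := hkey.trans hMa
  · have hexp : σ * (2 * m + d - 1) / d = σ + e := by
      rw [he]
      field_simp
      ring
    rw [hexp, Real.rpow_add hTpos]
    calc 2 * (J : ℝ) * 2 ^ t ≤ 2 * (2 ^ m * (b * τ)) * (2 * ((2 ^ T) ^ m * (g * (T : ℝ) ^ e))) := by
          gcongr
          exact hJs.trans (by gcongr)
      _ = _ := by rw [pow_add, hτ]; ring

/-- Almost every matrix has well separated rows and quantitatively dense orbits. -/
theorem ae_gap_and_dense {d m : ℕ} (hd : 0 < d) (hm : 0 < m) {σ : ℝ} (hσ : 1 < σ) :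
    ∃ K : ℝ, 0 < K ∧ ∀ᵐ α : Fin m → Fin d → ℝ, ∀ᶠ T : ℕ in atTop,
      (∀ j, ∀ n : Fin d → ℤ, n ≠ 0 → (∀ i, |n i| ≤ 2 ^ T) → ∀ p : ℤ,
        (rate d σ T)⁻¹ < |∑ i, α j i * n i - p|) ∧
      ∀ x : Fin m → ℝ, ∃ (n : Fin d → ℤ) (p : Fin m → ℤ),
        (∀ i, |(n i : ℝ)| ≤ K * (2 ^ T) ^ m * (T : ℝ) ^ (σ * (2 * m + d - 1) / d)) ∧
        ∀ j, |x j - ∑ i, α j i * n i - p j| ≤ (rate d σ T)⁻¹ / 4 := by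
  have hσ0 : 0 < σ := by linarith
  obtain ⟨K, hK, hpar⟩ := exists_parameters hd hm hσ
  refine ⟨K, hK, ?_⟩
  have hrow := ae_forall_row_eventually_forall_lt_abs_sub (ι := Fin m) (d := d)
    (ψ := fun t => (rate d σ t)⁻¹) (fun t => inv_nonneg.2 (rate_nonneg _ _ _))
    (fun t => by simpa using rate_rpow_inv_le_one (d := d) hσ0 1 one_pos t) (summable_rate hσ)
  have hall := ae_eventually_forall_lt_abs_sub (ι := Fin m) (d := d)
    (ψ := fun t => (rate d σ t ^ ((m : ℝ)⁻¹))⁻¹)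
    (fun t => inv_nonneg.2 (Real.rpow_nonneg (rate_nonneg _ _ _) _))
    (fun t => rate_rpow_inv_le_one hσ0 m hm t) (by
      simpa only [Fintype.card_fin, inv_pow, Real.rpow_inv_natCast_pow (rate_nonneg d σ _) hm.ne']
        using summable_rate hσ)
  filter_upwards [hrow, hall] with α hα1 hα2
  obtain ⟨t₀, ht₀⟩ := eventually_atTop.1 hα2
  filter_upwards [eventually_all.2 hα1, hpar, eventually_ge_atTop t₀] with T hT1 hT2 hT3
  refine ⟨hT1, fun x => ?_⟩
  -- Density at scale T uses joint separation at the larger scale t.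
  obtain ⟨t, htT, M, J, hM, hMψ, hJ, hJM, hR⟩ := hT2
  let f : (Fin d → ℤ) →+ (Fin m → ℝ) :=
    { toFun := fun n j => ∑ i, α j i * n i
      map_zero' := by ext; simp
      map_add' := fun n n' => by ext; simp [mul_add, Finset.sum_add_distrib] }
  obtain ⟨n, p, hn, hp⟩ := reachable_of_separated (f := f) (X := 2 ^ t) hM hJ
    (fun n hn hnt p => by
      obtain ⟨j, hj⟩ := ht₀ t (hT3.trans htT) n hn (by exact_mod_cast hnt) p
      exact ⟨j, hMψ.trans hj.le⟩) x
  refine ⟨n, p, fun i => le_trans ?_ hR, fun j => (hp j).trans ?_⟩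
  · exact_mod_cast hn i
  · push_cast
    exact hJM

/-! ### The slice, regularity and patches in offset coordinates -/

/-- The coordinates `z₂ - L z₁` of a point along the last factor, modulo the physical space. -/
noncomputable def offset {d m : ℕ} (α : Fin m → Fin d → ℝ) : Total d m →ₗ[ℝ] (Fin m → ℝ) :=
  LinearMap.snd ℝ _ _ - (linMap α).comp (LinearMap.fst ℝ _ _)

section Geometry

variable {d m : ℕ} {α : Fin m → Fin d → ℝ}

theorem linMap_apply (v : Fin d → ℝ) (j : Fin m) : linMap α v j = ∑ i, α j i * v i := by
  simp [linMap, Matrix.toLin'_apply, Matrix.mulVec, dotProduct]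

theorem offset_apply (z : Total d m) (j : Fin m) :
    offset α z j = z.2 j - ∑ i, α j i * z.1 i := by
  simp [offset, linMap_apply]

theorem mem_physicalSpace_iff {z : Total d m} : z ∈ physicalSpace α ↔ offset α z = 0 := by
  rw [physicalSpace, LinearMap.mem_graph_iff, ← sub_eq_zero]
  rfl

theorem add_mem_lattice {z w : Total d m} (hz : z ∈ lattice d m) (hw : w ∈ lattice d m) :
    z + w ∈ lattice d m := by
  refine ⟨fun i => ?_, fun j => ?_⟩
  · obtain ⟨a, ha⟩ := hz.1 i
    obtain ⟨b, hb⟩ := hw.1 i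
    exact ⟨a + b, by simp [ha, hb]⟩
  · obtain ⟨a, ha⟩ := hz.2 j
    obtain ⟨b, hb⟩ := hw.2 j
    exact ⟨a + b, by simp [ha, hb]⟩

theorem add_mem_shiftedLattice {s z w : Total d m} (hz : z ∈ shiftedLattice s)
    (hw : w ∈ lattice d m) : z + w ∈ shiftedLattice s := by
  have : z + w - s = (z - s) + w := by abel
  rw [shiftedLattice, Set.mem_ofPred_eq, this]
  exact add_mem_lattice hz hw

variable {F : Submodule ℝ (Total d m)} (h : IsCompl (physicalSpace α) F)

theorem offset_projStar (z : Total d m) : offset α (projStar h z) = offset α z := by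
  have h1 := mem_physicalSpace_iff.1 (Submodule.sub_projection_mem h.symm z)
  rw [map_sub, sub_eq_zero] at h1
  exact h1.symm

/-- The offset vanishes exactly on E and is unchanged by π^*, so the choice of F does not affect the
slice. -/
theorem mem_slice_iff {z : Total d m} :
    z ∈ slice h ↔ ∀ j, offset α z j ∈ Set.Icc (0 : ℝ) 1 := by
  constructor
  · rintro ⟨_, ⟨c, hc, rfl⟩, e, he, rfl⟩ j
    have h1 : offset α (projStar h c + e) = offset α c := by
      rw [map_add, offset_projStar, mem_physicalSpace_iff.1 he, add_zero]
    change offset α (projStar h c + e) j ∈ _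
    rw [h1, offset_apply, hc.1]
    simpa using hc.2 j
  · intro hz
    have h1 : offset α ((0, offset α z) : Total d m) = offset α z := by
      ext j
      rw [offset_apply]
      simp
    refine ⟨projStar h (0, offset α z), ⟨_, ⟨rfl, hz⟩, rfl⟩, z - projStar h (0, offset α z),
      ?_, by simp⟩
    rw [SetLike.mem_coe, mem_physicalSpace_iff, map_sub, offset_projStar, h1, sub_self]

/-- Moving along -(0, (1, …, 1)) makes the j-th offset negative at once. -/
theorem mem_frontier_slice {z : Total d m} (hz : z ∈ slice h) {j : Fin m}
    (hj : offset α z j = 0) : z ∈ frontier (slice h) := by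
  refine ⟨subset_closure hz, fun hint => ?_⟩
  let γ : ℝ → Total d m := fun t => z + t • ((0, fun _ => 1) : Total d m)
  have hγ : Continuous γ := by fun_prop
  have h0 : γ 0 = z := by simp [γ]
  have hev : ∀ᶠ t in nhds (0 : ℝ), γ t ∈ slice h := by
    apply hγ.continuousAt.eventually_mem
    rw [h0]
    exact mem_interior_iff_mem_nhds.1 hint
  obtain ⟨t, ht, ht0⟩ :=
    ((hev.filter_mono nhdsWithin_le_nhds).and (self_mem_nhdsWithin (s := Set.Iio (0 : ℝ)))).exists
  have h1 := ((mem_slice_iff h).1 ht j).1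
  have h2 : offset α (γ t) j = t := by
    simp only [γ, map_add, map_smul, Pi.add_apply, hj, Pi.smul_apply]
    rw [offset_apply]
    simp
  rw [h2] at h1
  exact absurd ht0 (not_lt.2 h1)

/-- For regular `s` the coordinates of a point of `ℤ^k + s` avoid the orbit of the origin. -/
theorem IsRegular.offset_ne {s : Total d m} (hs : IsRegular h s) {z : Total d m}
    (hz : z ∈ shiftedLattice s) (j : Fin m) (n : Fin d → ℤ) (p : ℤ) :
    offset α z j ≠ ∑ i, α j i * n i - p := by
  intro heq
  -- Integer shifts bring all offsets into [0,1); the j-th becomes 0, a boundary point.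
  let q : Fin m → ℤ := fun l => -⌊offset α z l - ∑ i, α l i * n i⌋
  let w : Total d m := (fun i => n i, fun l => q l)
  have hw : w ∈ lattice d m := ⟨fun i => ⟨n i, rfl⟩, fun l => ⟨q l, rfl⟩⟩
  have hoff : ∀ l, offset α (z + w) l = Int.fract (offset α z l - ∑ i, α l i * n i) := fun l => by
    rw [map_add, Pi.add_apply, offset_apply w, Int.fract]
    simp only [w, q, Int.cast_neg]
    ring
  have hmem : z + w ∈ slice h := by
    rw [mem_slice_iff]
    intro l
    rw [hoff]
    exact ⟨Int.fract_nonneg _, (Int.fract_lt_one _).le⟩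
  have hj : offset α (z + w) j = 0 := by
    rw [hoff, heq]
    have : ∑ i, α j i * (n i : ℝ) - p - ∑ i, α j i * n i = ((-p : ℤ) : ℝ) := by
      push_cast
      ring
    rw [this, Int.fract_intCast]
  have : z + w ∈ frontier (slice h) ∩ shiftedLattice s :=
    ⟨mem_frontier_slice h hmem hj, add_mem_shiftedLattice hz hw⟩
  rw [hs] at this
  exact this

variable {h}

theorem injOn_shiftedLattice (hinj : Set.InjOn (proj h) (lattice d m)) (s : Total d m) :
    Set.InjOn (proj h) (shiftedLattice s) := fun z hz w hw hzw => by
  have := hinj hz hw (by rw [map_sub, map_sub, hzw])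
  simpa using this

/-- Injectivity makes lifts unique, so a patch is encoded by the lattice vectors that keep its lift
in the slice. -/
theorem patch_image_subset (hinj : Set.InjOn (proj h) (lattice d m)) {s z₁ z₂ : Total d m} {r : ℝ}
    (hz₁ : z₁ ∈ shiftedLattice s) (hz₂ : z₂ ∈ shiftedLattice s)
    (H : ∀ n ∈ cylinder d m r, z₁ + n ∈ slice h → z₂ + n ∈ slice h) :
    (fun y => y - proj h z₁) '' patch h s (proj h z₁) r ⊆
      (fun y => y - proj h z₂) '' patch h s (proj h z₂) r := by
  have hinj' := injOn_shiftedLattice hinj s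
  rintro _ ⟨y', ⟨⟨v, ⟨hv, hvs⟩, hvy⟩, w, hw, w', hw', hwz, rfl, hn⟩, rfl⟩
  obtain rfl := hinj' hw hz₁ hwz
  obtain rfl := hinj' hvs hw' hvy
  have hmem := add_mem_shiftedLattice hz₂ hn.1
  refine ⟨proj h (z₂ + (v - w)), ⟨⟨_, ⟨H _ hn (by simpa using hv), hmem⟩, rfl⟩, z₂, hz₂, _, hmem,
    rfl, rfl, by simpa using hn⟩, ?_⟩
  simp

theorem patchEquiv_of_mem_slice_iff (hinj : Set.InjOn (proj h) (lattice d m))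
    {s z₁ z₂ : Total d m} {r : ℝ} (hz₁ : z₁ ∈ shiftedLattice s) (hz₂ : z₂ ∈ shiftedLattice s)
    (H : ∀ n ∈ cylinder d m r, z₁ + n ∈ slice h ↔ z₂ + n ∈ slice h) :
    PatchEquiv h s r (proj h z₁) (proj h z₂) :=
  (patch_image_subset hinj hz₁ hz₂ fun n hn => (H n hn).1).antisymm
    (patch_image_subset hinj hz₂ hz₁ fun n hn => (H n hn).2)

/-- Next to a point outside a `δ`-separated set there is an interval of length `δ / 2` that lies
on the same side of every point of the set. -/
theorem exists_center {D : Set ℝ} {δ u₀ : ℝ}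
    (hD : ∀ x ∈ D, ∀ y ∈ D, x ≠ y → δ < |x - y|) (hu₀ : u₀ ∉ D) :
    ∃ c, ∀ u, |u - c| ≤ δ / 4 → ∀ x ∈ D, (x ≤ u ↔ x ≤ u₀) ∧ (u ≤ x ↔ u₀ ≤ x) := by
  have hne : ∀ x ∈ D, x ≠ u₀ := fun x hx he => hu₀ (he ▸ hx)
  -- A point of D within δ/2 to the right of u₀ leaves [u₀ - δ/2, u₀] free by separation; otherwise
  -- [u₀, u₀ + δ/2] is free.
  by_cases H : ∃ x ∈ D, u₀ ≤ x ∧ x ≤ u₀ + δ / 2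
  · obtain ⟨x, hx, hx1, hx2⟩ := H
    have hx3 := lt_of_le_of_ne hx1 (hne x hx).symm
    refine ⟨u₀ - δ / 4, fun u hu y hy => ?_⟩
    rw [abs_le] at hu
    rcases lt_or_gt_of_ne (hne y hy) with hlt | hgt
    · have := hD x hx y hy (by linarith)
      rw [abs_of_pos (by linarith)] at this
      constructor <;> constructor <;> intro <;> linarith
    · constructor <;> constructor <;> intro <;> linarith
  · push Not at H
    refine ⟨u₀ + δ / 4, fun u hu y hy => ?_⟩
    rw [abs_le] at hu
    rcases lt_or_gt_of_ne (hne y hy) with hlt | hgt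
    · constructor <;> constructor <;> intro <;> linarith
    · have := H y hy hgt.le
      constructor <;> constructor <;> intro <;> linarith

/-- Row gaps and density of the orbit give a nearby occurrence of every patch. -/
theorem exists_patchEquiv (hinj : Set.InjOn (proj h) (lattice d m)) {s : Total d m}
    (hs : IsRegular h s) {r δ R Q : ℝ} (hr : 0 ≤ r) (hδ1 : δ < 1) (hQ : 2 * r ≤ Q)
    (hgap : ∀ j, ∀ n : Fin d → ℤ, n ≠ 0 → (∀ i, |(n i : ℝ)| ≤ Q) → ∀ p : ℤ,
      δ < |∑ i, α j i * n i - p|)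
    (hdense : ∀ x : Fin m → ℝ, ∃ (n : Fin d → ℤ) (p : Fin m → ℤ),
      (∀ i, |(n i : ℝ)| ≤ R) ∧ ∀ j, |x j - ∑ i, α j i * n i - p j| ≤ δ / 4)
    {z₀ z : Total d m} (hz₀ : z₀ ∈ slice h ∩ shiftedLattice s) (hz : z ∈ shiftedLattice s) :
    ∃ w ∈ lattice d m, (∀ i, |w.1 i| ≤ R) ∧ z + w ∈ slice h ∧
      PatchEquiv h s r (proj h (z + w)) (proj h z₀) := by
  let D : Fin m → Set ℝ := fun j =>
    {x | ∃ (n : Fin d → ℤ) (p : ℤ), (∀ i, |(n i : ℝ)| ≤ r) ∧ x = ∑ i, α j i * n i - p}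
  have hsep : ∀ j, ∀ x ∈ D j, ∀ y ∈ D j, x ≠ y → δ < |x - y| := by
    rintro j _ ⟨n, p, hn, rfl⟩ _ ⟨n', p', hn', rfl⟩ hne
    by_cases hnn : n = n'
    · subst hnn
      have hpp : p' - p ≠ 0 := fun h0 => hne (by rw [sub_eq_zero.1 h0])
      have h1 : (1 : ℝ) ≤ |((p' - p : ℤ) : ℝ)| := by exact_mod_cast Int.one_le_abs hpp
      have h2 : ∑ i, α j i * (n i : ℝ) - p - (∑ i, α j i * n i - p') = ((p' - p : ℤ) : ℝ) := by
        push_cast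
        ring
      rw [h2]
      exact hδ1.trans_le h1
    · have h1 := hgap j (n - n') (sub_ne_zero.2 hnn) (fun i => by
        have := (abs_sub (n i : ℝ) (n' i)).trans (add_le_add (hn i) (hn' i))
        rw [Pi.sub_apply, Int.cast_sub]
        linarith) (p - p')
      convert h1 using 2
      simp only [Pi.sub_apply, Int.cast_sub, mul_sub, Finset.sum_sub_distrib]
      ring
  have hcen := fun j => exists_center (u₀ := offset α z₀ j) (hsep j) (by
    rintro ⟨n, p, -, hp⟩
    exact hs.offset_ne h hz₀.2 j n p hp)
  choose c hc using hcen
  obtain ⟨n, p, hn, hp⟩ := hdense (fun j => offset α z j - c j)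
  let w : Total d m := (fun i => n i, fun j => ((-p j : ℤ) : ℝ))
  have hw : w ∈ lattice d m := ⟨fun i => ⟨n i, rfl⟩, fun j => ⟨-p j, rfl⟩⟩
  have hwc : ∀ j, |offset α (z + w) j - c j| ≤ δ / 4 := fun j => by
    convert hp j using 2
    rw [map_add, Pi.add_apply, offset_apply w]
    simp only [w, Int.cast_neg]
    ring
  have hiff : ∀ v ∈ cylinder d m r, z + w + v ∈ slice h ↔ z₀ + v ∈ slice h := by
    rintro v ⟨⟨hv1, hv2⟩, hv⟩
    choose a ha using hv1
    rw [mem_slice_iff, mem_slice_iff]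
    refine forall_congr' fun j => ?_
    obtain ⟨b, hb⟩ := hv2 j
    have har : ∀ i, |(a i : ℝ)| ≤ r := fun i => by
      rw [← ha i]
      exact abs_le.2 (hv i)
    have hoff : offset α v j = b - ∑ i, α j i * a i := by
      rw [offset_apply, hb]
      simp only [ha]
    -- The two ends 0 and 1 of the window give the thresholds with p = b and p = b - 1.
    have h1 := (hc j _ (hwc j) _ ⟨a, b, har, rfl⟩).1
    have h2 := (hc j _ (hwc j) _ ⟨a, b - 1, har, rfl⟩).2
    push_cast at h2
    rw [map_add, map_add _ z₀, Pi.add_apply, Pi.add_apply, hoff, Set.mem_Icc, Set.mem_Icc]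
    refine and_congr ⟨fun h3 => ?_, fun h3 => ?_⟩ ⟨fun h3 => ?_, fun h3 => ?_⟩
    · linarith [h1.1 (by linarith)]
    · linarith [h1.2 (by linarith)]
    · linarith [h2.1 (by linarith)]
    · linarith [h2.2 (by linarith)]
  refine ⟨w, hw, hn, ?_, patchEquiv_of_mem_slice_iff hinj (add_mem_shiftedLattice hz hw) hz₀.2 hiff⟩
  have h0 : (0 : Total d m) ∈ cylinder d m r :=
    ⟨⟨fun i => ⟨0, by simp⟩, fun j => ⟨0, by simp⟩⟩, fun i => by simpa using hr⟩
  have := (hiff 0 h0).2 (by simpa using hz₀.1)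
  simpa using this

end Geometry

/-! ### Distances in E and the repetitivity bound -/

section Geometry

variable {d m : ℕ} {α : Fin m → Fin d → ℝ} {F : Submodule ℝ (Total d m)}

/-- The projection of a vector with bounded offset is controlled by its first coordinates. -/
theorem exists_norm_proj_le (h : IsCompl (physicalSpace α) F) :
    ∃ B : ℝ, 0 ≤ B ∧ ∀ (w : Total d m) (R : ℝ), 1 ≤ R → (∀ i, |w.1 i| ≤ R) →
      (∀ j, |offset α w j| ≤ 1) → ‖proj h w‖ ≤ B * R := by
  let P : Total d m →L[ℝ] Total d m := (proj h).toContinuousLinearMap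
  let A : (Fin d → ℝ) →L[ℝ] Total d m :=
    ((proj h).comp (LinearMap.id.prod (linMap α))).toContinuousLinearMap
  refine ⟨‖A‖ + ‖P‖, by positivity, fun w R hR hw ho => ?_⟩
  have hsplit : w = (w.1, linMap α w.1) + ((0 : Fin d → ℝ), offset α w) := by
    ext i
    · simp
    · simp [offset_apply, linMap_apply]
  have hproj : proj h w = A w.1 + P (0, offset α w) := by
    conv_lhs => rw [hsplit, map_add]
    rfl
  have h1 : ‖w.1‖ ≤ R := (pi_norm_le_iff_of_nonneg (by linarith)).2 hw
  have h2 : ‖((0 : Fin d → ℝ), offset α w)‖ ≤ 1 := by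
    rw [Prod.norm_def, norm_zero]
    exact max_le zero_le_one ((pi_norm_le_iff_of_nonneg zero_le_one).2 ho)
  rw [hproj]
  calc ‖A w.1 + P (0, offset α w)‖ ≤ ‖A‖ * ‖w.1‖ + ‖P‖ * ‖((0 : Fin d → ℝ), offset α w)‖ :=
        (norm_add_le _ _).trans (add_le_add (A.le_opNorm _) (P.le_opNorm _))
    _ ≤ ‖A‖ * R + ‖P‖ * R := by
        gcongr
        exact h2.trans hR
    _ = _ := by ring

end Geometry

/-- A power of two comparable to `2 r`, together with the bound of its exponent by `log r`. -/
theorem exists_pow_two_near {r : ℝ} (hr : 4 ≤ r) (T₀ : ℕ) (hT₀ : 2 ^ T₀ ≤ r) :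
    ∃ T : ℕ, T₀ ≤ T ∧ 1 ≤ T ∧ 2 * r ≤ 2 ^ T ∧ (2 : ℝ) ^ T ≤ 4 * r ∧ (T : ℝ) ≤ 4 * Real.log r := by
  obtain ⟨n, hn1, hn2⟩ := exists_nat_pow_near (x := 2 * r) (y := (2 : ℝ)) (by linarith)
    (by norm_num)
  have h4 : (2 : ℝ) ^ (n + 1) ≤ 4 * r := by
    rw [pow_succ]
    linarith
  refine ⟨n + 1, ?_, by omega, hn2.le, h4, ?_⟩
  · exact ((pow_lt_pow_iff_right₀ (one_lt_two (α := ℝ))).1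
      (by linarith : (2 : ℝ) ^ T₀ < 2 ^ (n + 1))).le
  · have h1 := Real.log_le_log (by positivity) h4
    rw [Real.log_pow, Real.log_mul (by norm_num) (by linarith)] at h1
    have h2 := Real.log_le_log (by norm_num) hr
    have h3 := Real.log_two_gt_d9
    have h5 : ((n + 1 : ℕ) : ℝ) * (1 / 2) ≤ ((n + 1 : ℕ) : ℝ) * Real.log 2 := by
      gcongr
      linarith
    linarith

theorem rate_inv_lt_one {d : ℕ} (hd : 0 < d) {σ : ℝ} (hσ : 0 ≤ σ) {T : ℕ} (hT : 1 ≤ T) :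
    (rate d σ T)⁻¹ < 1 :=
  inv_lt_one_of_one_lt₀ (one_lt_mul_of_lt_of_le
    (one_lt_pow₀ (one_lt_pow₀ (by norm_num) (by omega)) hd.ne')
    (Real.one_le_rpow (by exact_mod_cast hT) hσ))

theorem ae_isRepetitive {d m : ℕ} (hd : 0 < d) (hm : 0 < m) {κ : ℝ}
    (hκ : (2 * m + d : ℝ) / d ≤ κ) :
    ∀ᵐ α : Fin m → Fin d → ℝ, ∀ (F : Submodule ℝ (Total d m))
      (h : IsCompl (physicalSpace α) F), Set.InjOn (proj h) (lattice d m) →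
      ∃ C : ℝ, 0 < C ∧ ∀ s : Total d m, IsRegular h s → ∀ φ : ℝ → ℝ,
        (∀ᶠ r in atTop, C * r ^ m * (Real.log r) ^ κ ≤ φ r) → IsRepetitive h s φ := by
  have hdr : (1 : ℝ) ≤ d := by exact_mod_cast hd
  have hmr : (1 : ℝ) ≤ m := by exact_mod_cast hm
  -- Solves σ(2m+d-1)/d = (2m+d)/d.
  set σ : ℝ := (2 * m + d) / (2 * m + d - 1) with hσdef
  have hσ : 1 < σ := by
    rw [hσdef, one_lt_div (by linarith)]
    linarith
  have hexp : σ * (2 * m + d - 1) / d = (2 * m + d : ℝ) / d := by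
    rw [hσdef, div_mul_cancel₀ _ (by linarith)]
  have hexp0 : (0 : ℝ) ≤ (2 * m + d : ℝ) / d := by positivity
  obtain ⟨K, hK, hae⟩ := ae_gap_and_dense hd hm hσ
  filter_upwards [hae] with α hα F h hinj
  obtain ⟨B, hB, hproj⟩ := exists_norm_proj_le h
  obtain ⟨T₀, hT₀⟩ := eventually_atTop.1 hα
  -- The fours come from 2^T ≤ 4r and T ≤ 4 log r; the added 1 ensures R ≥ 1.
  set K' : ℝ := K * 4 ^ m * 4 ^ ((2 * m + d : ℝ) / d) + 1 with hK'
  have hK'1 : 1 ≤ K' := by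
    rw [hK']
    have : 0 ≤ K * 4 ^ m * (4 : ℝ) ^ ((2 * m + d : ℝ) / d) := by positivity
    linarith
  refine ⟨(B + 1) * K', by positivity, fun s hs φ hφ => ?_⟩
  filter_upwards [hφ, eventually_ge_atTop 4, eventually_ge_atTop (2 ^ T₀)] with r hφr hr4 hrT
  rintro _ ⟨z₀, hz₀, rfl⟩ _ ⟨z, hz, rfl⟩
  obtain ⟨T, hTT₀, hT1, hrT1, hrT2, hTlog⟩ := exists_pow_two_near hr4 T₀ hrT
  obtain ⟨hgap, hdense⟩ := hT₀ T hTT₀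
  have hlog : 1 ≤ Real.log r := by
    have h1 := Real.log_le_log (by norm_num) hr4
    have h2 : Real.log 4 = 2 * Real.log 2 := by
      rw [show (4 : ℝ) = 2 ^ 2 by norm_num, Real.log_pow]
      norm_num
    linarith [Real.log_two_gt_d9]
  set R : ℝ := K' * r ^ m * (Real.log r) ^ κ with hR
  have hrm : 1 ≤ r ^ m := one_le_pow₀ (by linarith)
  have hlogκ : 1 ≤ (Real.log r) ^ κ := Real.one_le_rpow hlog (hexp0.trans hκ)
  have hR1 : 1 ≤ R := one_le_mul_of_one_le_of_one_le
    (one_le_mul_of_one_le_of_one_le hK'1 hrm) hlogκ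
  have hbound : K * (2 ^ T) ^ m * (T : ℝ) ^ (σ * (2 * m + d - 1) / d) ≤ R := by
    rw [hexp]
    calc K * (2 ^ T) ^ m * (T : ℝ) ^ ((2 * m + d : ℝ) / d)
        ≤ K * (4 * r) ^ m * (4 * Real.log r) ^ ((2 * m + d : ℝ) / d) := by
          gcongr
      _ = K * 4 ^ m * 4 ^ ((2 * m + d : ℝ) / d) * r ^ m *
            (Real.log r) ^ ((2 * m + d : ℝ) / d) := by
          rw [mul_pow, Real.mul_rpow (by norm_num) (by linarith)]
          ring
      _ ≤ K' * r ^ m * (Real.log r) ^ κ := by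
          gcongr
          · rw [hK']
            linarith
  obtain ⟨w, hw, hwR, hmem, hequiv⟩ := exists_patchEquiv hinj hs (by linarith)
    (rate_inv_lt_one hd (by linarith) hT1) hrT1
    (fun j n hn hnQ p => hgap j n hn (fun i => by exact_mod_cast hnQ i) p)
    (fun x => by
      obtain ⟨n, p, hn, hp⟩ := hdense x
      exact ⟨n, p, fun i => (hn i).trans hbound, hp⟩) hz₀ hz.2
  refine ⟨_, ⟨z + w, ⟨hmem, add_mem_shiftedLattice hz.2 hw⟩, rfl⟩, ?_, hequiv⟩
  -- Both z and z + w lie in the slice, so w has bounded offset.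
  have hoff : ∀ j, |offset α w j| ≤ 1 := fun j => by
    have h1 := (mem_slice_iff h).1 hmem j
    have h2 := (mem_slice_iff h).1 hz.1 j
    rw [map_add, Pi.add_apply, Set.mem_Icc] at h1
    rw [Set.mem_Icc] at h2
    rw [abs_le]
    constructor <;> linarith
  rw [Metric.mem_ball, dist_eq_norm, map_add, add_sub_cancel_left]
  calc ‖proj h w‖ ≤ B * R := hproj w R hR1 hwR hoff
    _ < (B + 1) * R := by linarith
    _ = (B + 1) * K' * r ^ m * (Real.log r) ^ κ := by
        rw [hR]
        ring
    _ ≤ φ r := hφr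

end CutProject

theorem mainTheorem7 (k d : ℕ) (hd : 0 < d) (hdk : d < k) (ε : ℝ) (hε : 0 < ε) :
    ∀ᵐ α : Fin (k - d) → Fin d → ℝ,
      ∀ (F : Submodule ℝ (CutProject.Total d (k - d)))
        (h : IsCompl (CutProject.physicalSpace α) F),
        Set.InjOn (CutProject.proj h) (CutProject.lattice d (k - d)) →
        ∃ C : ℝ, 0 < C ∧
          ∀ s : CutProject.Total d (k - d), CutProject.IsRegular h s →
            ∀ φ : ℝ → ℝ,
              (∀ᶠ r in atTop,
                C * r ^ (k - d) * (Real.log r) ^ (2 * (k : ℝ) / (d : ℝ) - 1 + ε) ≤ φ r) →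
              CutProject.IsRepetitive h s φ := by
  refine CutProject.ae_isRepetitive hd (Nat.sub_pos_of_lt hdk) ?_
  have hdr : (d : ℝ) ≠ 0 := by exact_mod_cast hd.ne'
  have heq : (2 * ((k - d : ℕ) : ℝ) + d) / d = 2 * (k : ℝ) / d - 1 := by
    rw [Nat.cast_sub hdk.le]
    field_simp
    ring
  rw [heq]
  linarith
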